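/- Let $\alpha$ be a finite measure on $(\mathbb{R},\mathcal{B}(\mathbb{R}))$ with total mass $a=\alpha(\mathbb{R})>0$. Let $\mathbb{P}$ be the space of all probability measures on $(\mathbb{R},\mathcal{B}(\mathbb{R}))$, with the Borel $\sigma$-algebra of the topology of weak convergence, and let $\mathcal{D}_\alpha$ be the functional Dirichlet distribution with parameter $\alpha$, i.e. the probability measure on $\mathbb{P}$ under which, for every partition $C_1,\dots,C_{n+1}$ of $\mathbb{R}$ into Borel sets, the random vector $(\varphi(C_1),\dots,\varphi(C_n))$ has the Dirichlet distribution with parameter $(b_1,\dots,b_{n+1})=(\alpha(C_1),\dots,\alpha(C_{n+1}))$. For strictly positive parameters this is the distribution on $\{u\in\mathbb{R}^n: u_i>0 \text{ for all } i,\ \sum_i u_i<1\}$ with density $$\frac{\Gamma(b_1+\cdots+b_{n+1})}{\Gamma(b_1)\cdots\Gamma(b_{n+1})}\,u_1^{b_1-1}\cdots u_n^{b_n-1}\Bigl(1-\sum_{i=1}^n u_i\Bigr)^{b_{n+1}-1};$$ cells with parameter $0$ have $\varphi$-mass $0$ almost surely and are otherwise ignored. Let $L=\{\varphi\in\mathbb{P}:\int_{\mathbb{R}}|x|\,\varphi(dx)<\infty\}$.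 Then $\mathcal{D}_\alpha(L)\in\{0,1\}$, and the following two conditions are equivalent: (i) $\mathcal{D}_\alpha(L)=1$; (ii) $\int_{\mathbb{R}}\log(1+|x|)\,\alpha(dx)<\infty$. Moreover, if $\mathcal{D}_\alpha(L)=1$, then for every $t\in\mathbb{R}$ (with principal branches of the power and the logarithm, and with both integrands integrable) $$\int_{\mathbb{P}}\Bigl(1+it\int_{\mathbb{R}}x\,\varphi(dx)\Bigr)^{-a}\,\mathcal{D}_\alpha(d\varphi)=\exp\Bigl\{-\int_{\mathbb{R}}\log(1+itx)\,\alpha(dx)\Bigr\}.$$ -/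

import Mathlib

open MeasureTheory

noncomputable section

/-- The open simplex `{u ∈ ℝⁿ : u_i > 0 for every i, u_1 + ⋯ + u_n < 1}`. -/
def openSimplex (n : ℕ) : Set (Fin n → ℝ) :=
  {u | (∀ i, 0 < u i) ∧ ∑ i, u i < 1}

/-- The function
`Γ(b_1 + ⋯ + b_{n+1}) / (Γ(b_1) ⋯ Γ(b_{n+1})) · u_1^{b_1 - 1} ⋯ u_n^{b_n - 1} (1 - |u|)^{b_{n+1} - 1}`,
which on the open simplex is the Dirichlet density. -/
def dirichletDensity {n : ℕ} (b : Fin (n + 1) → ℝ) (u : Fin n → ℝ) : ℝ :=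
  Real.Gamma (∑ i, b i) / (∏ i, Real.Gamma (b i)) *
    (∏ i : Fin n, u i ^ (b i.castSucc - 1)) * (1 - ∑ i, u i) ^ (b (Fin.last n) - 1)

/-- The Dirichlet distribution on `ℝⁿ` with strictly positive parameters `b_1, …, b_{n+1}`. -/
def dirichletMeasure {n : ℕ} (b : Fin (n + 1) → ℝ) : Measure (Fin n → ℝ) :=
  (volume.restrict (openSimplex n)).withDensity fun u => ENNReal.ofReal (dirichletDensity b u)

/-- `C_1, …, C_m` is a partition of `ℝ` into Borel sets (empty cells are allowed). -/
structure IsBorelPartition {m : ℕ} (C : Fin m → Set ℝ) : Prop where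
  measurableSet : ∀ i, MeasurableSet (C i)
  disjoint : Pairwise fun i j => Disjoint (C i) (C j)
  iUnion_eq : ⋃ i, C i = Set.univ

/-- `D` is the functional Dirichlet distribution with parameter `α`, that is, the law, on the space
of probability measures on `ℝ`, of a Dirichlet process `φ` with parameter `α`: for every Borel
partition `C_1, …, C_{n+1}` of `ℝ`, the vector `(φ(C_1), …, φ(C_n))` has the Dirichlet distribution
with parameter `(α(C_1), …, α(C_{n+1}))`. A vanishing Dirichlet parameter means, as usual, that the
corresponding coordinate is almost surely zero and that the other coordinates are distributed as if
it were absent; `null` together with `positive` (in which a null cell can be merged with another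
cell) says just this.

The space `ProbabilityMeasure ℝ` carries the σ-algebra generated by the evaluations `φ ↦ φ(B)`,
which is the Borel σ-algebra of the topology of weak convergence. -/
structure IsFunctionalDirichlet (α : Measure ℝ) (D : Measure (ProbabilityMeasure ℝ)) : Prop where
  isProbabilityMeasure : IsProbabilityMeasure D
  positive : ∀ (n : ℕ) (C : Fin (n + 1) → Set ℝ), IsBorelPartition C → (∀ i, 0 < α (C i)) →
    D.map (fun (φ : ProbabilityMeasure ℝ) (i : Fin n) => (φ : Measure ℝ).real (C i.castSucc)) =
      dirichletMeasure fun i => α.real (C i)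
  null : ∀ B : Set ℝ, MeasurableSet B → α B = 0 → ∀ᵐ φ : ProbabilityMeasure ℝ ∂D, (φ : Measure ℝ) B = 0

/-- The set of the probability measures on `ℝ` whose absolute first moment is finite. -/
def finiteMeanSet : Set (ProbabilityMeasure ℝ) :=
  {φ | ∫⁻ x, ENNReal.ofReal |x| ∂(φ : Measure ℝ) < ⊤}

end

open Set Filter Topology ProbabilityTheory

/-! Everything rests on the Markov–Krein identity `∫ (∫ f dφ)^(-a) D(dφ) = exp (-∫ log f dα)`. If
`f` takes finitely many values `z_i`, on cells of `α`-mass `b_i > 0`, it is a Dirichlet integral: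
integrate `∏ y_i^(b_i - 1) exp (-z_i y_i)` over the positive orthant, once as a product of Gamma
integrals and once in the coordinates total `s` and ratios `u`, doing the `s`-integral first
(`integral_dirichletKernel`). Simple functions approximate a general `f` with `Re f ≥ 1`; there
`|w^(-a)| ≤ 1`, so dominated convergence applies (`IsFunctionalDirichlet.integral_cpow`). Taking `f
= 1 + itx` gives the final formula.

For real `f ≥ 1`, truncation extends the identity to infinite integrals, with `∞^(-a) = 0`. Apply it
to `f = 1 + ε|x|`. If `∫ log (1 + |x|) dα = ∞`, the left side is zero, so `∫ |x| dφ = ∞` almost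
surely. If it is finite, the left side is at most `D(L)`, because its integrand is bounded by `1`
and vanishes off `L`; the right side tends to `1` as `ε → 0`, so `D(L) = 1`. The dichotomy thus
needs no separate zero-one law. -/

/-! ### The Gamma integral with complex rate. -/

lemma integrableOn_rpow_mul_exp_neg_mul {b r : ℝ} (hb : 0 < b) (hr : 0 < r) :
    IntegrableOn (fun y : ℝ => y ^ (b - 1) * Real.exp (-(r * y))) (Ioi 0) := by
  apply Integrable.of_integral_ne_zero
  rw [Real.integral_rpow_mul_exp_neg_mul_Ioi hb hr]
  have := Real.Gamma_pos_of_pos hb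
  positivity

lemma norm_rpow_mul_cexp_neg_mul {b : ℝ} (z : ℂ) {y : ℝ} (hy : 0 < y) :
    ‖((y ^ (b - 1) : ℝ) : ℂ) * Complex.exp (-(z * y))‖ =
      y ^ (b - 1) * Real.exp (-(z.re * y)) := by
  rw [norm_mul, Complex.norm_exp, Complex.norm_real, Real.norm_of_nonneg (by positivity)]
  simp

lemma integrableOn_rpow_mul_cexp_neg_mul {b : ℝ} {z : ℂ} (hb : 0 < b) (hz : 0 < z.re) :
    IntegrableOn (fun y : ℝ => ((y ^ (b - 1) : ℝ) : ℂ) * Complex.exp (-(z * y))) (Ioi 0) := by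
  refine Integrable.mono' (integrableOn_rpow_mul_exp_neg_mul hb hz)
    (Measurable.aestronglyMeasurable (by fun_prop)) ?_
  filter_upwards [ae_restrict_mem measurableSet_Ioi] with y hy
  exact (norm_rpow_mul_cexp_neg_mul z hy).le

/-- Analytic continuation from positive real rates: the left side is the complex moment generating
function of `y^(b - 1) dy` at `-z`, and both sides are analytic for `Re z > 0`. -/
lemma integral_rpow_mul_cexp_neg_mul {b : ℝ} {z : ℂ} (hb : 0 < b) (hz : 0 < z.re) :
    ∫ y : ℝ in Ioi 0, ((y ^ (b - 1) : ℝ) : ℂ) * Complex.exp (-(z * y)) =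
      z ^ (-(b : ℂ)) * (Real.Gamma b : ℂ) := by
  set μ : Measure ℝ := (volume.restrict (Ioi 0)).withDensity
    fun y => ENNReal.ofReal (y ^ (b - 1)) with hμ
  have hmeas : Measurable fun y : ℝ => ENNReal.ofReal (y ^ (b - 1)) := by fun_prop
  have key : ∀ w : ℂ, complexMGF id μ w =
      ∫ y : ℝ in Ioi 0, ((y ^ (b - 1) : ℝ) : ℂ) * Complex.exp (-(-w * y)) := by
    intro w
    rw [complexMGF, hμ, integral_withDensity_eq_integral_toReal_smul hmeas (by simp)]
    refine setIntegral_congr_fun measurableSet_Ioi fun y hy => ?_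
    have hy' : 0 ≤ y ^ (b - 1) := Real.rpow_nonneg (mem_Ioi.1 hy).le _
    simp [ENNReal.toReal_ofReal hy', Complex.real_smul]
  have hint : Iio 0 ⊆ integrableExpSet id μ := by
    intro t ht
    simp only [integrableExpSet, mem_ofPred_eq, id]
    rw [hμ, integrable_withDensity_iff hmeas (by simp)]
    refine (integrableOn_rpow_mul_exp_neg_mul hb (neg_pos.2 ht)).congr_fun (fun y hy => ?_)
      measurableSet_Ioi
    have hy' : 0 ≤ y ^ (b - 1) := Real.rpow_nonneg (mem_Ioi.1 hy).le _
    simp [ENNReal.toReal_ofReal hy', mul_comm]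
  have hsub : {w : ℂ | w.re < 0} ⊆ {w : ℂ | w.re ∈ interior (integrableExpSet id μ)} :=
    fun w hw => interior_maximal hint isOpen_Iio hw
  have hopen : IsOpen {w : ℂ | w.re < 0} := isOpen_lt Complex.continuous_re continuous_const
  have h1 : AnalyticOnNhd ℂ (complexMGF id μ) {w : ℂ | w.re < 0} :=
    analyticOnNhd_complexMGF.mono hsub
  have h2 : AnalyticOnNhd ℂ (fun w : ℂ => (-w) ^ (-(b : ℂ)) * (Real.Gamma b : ℂ))
      {w : ℂ | w.re < 0} := by
    apply DifferentiableOn.analyticOnNhd _ hopen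
    intro w hw
    refine DifferentiableAt.differentiableWithinAt ?_
    refine DifferentiableAt.mul_const ?_ _
    refine DifferentiableAt.cpow (by fun_prop) (by fun_prop) ?_
    left
    simpa using hw
  have hpre : IsPreconnected {w : ℂ | w.re < 0} :=
    (convex_halfSpace_re_lt 0).isPreconnected
  have hfreq : ∃ᶠ w in 𝓝[≠] (-1 : ℂ),
      complexMGF id μ w = (-w) ^ (-(b : ℂ)) * (Real.Gamma b : ℂ) := by
    have hreal : ∀ r : ℝ, 0 < r → complexMGF id μ (-r : ℂ) =
        (-(-r : ℂ)) ^ (-(b : ℂ)) * (Real.Gamma b : ℂ) := by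
      intro r hr
      rw [key]
      have := Real.integral_rpow_mul_exp_neg_mul_Ioi hb hr
      rw [neg_neg, ← Complex.ofReal_neg, ← Complex.ofReal_cpow hr.le, ← Complex.ofReal_mul,
        Real.rpow_neg hr.le, ← Real.inv_rpow hr.le, ← one_div, ← this, ← integral_complex_ofReal]
      refine integral_congr_ae (ae_of_all _ fun y => ?_)
      simp
    have ht : Tendsto (fun r : ℝ => (-r : ℂ)) (𝓝[≠] 1) (𝓝[≠] (-1 : ℂ)) := by
      refine tendsto_nhdsWithin_iff.2 ⟨?_, ?_⟩
      · refine Tendsto.mono_left ?_ nhdsWithin_le_nhds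
        exact Continuous.tendsto' (by fun_prop) _ _ (by simp)
      · filter_upwards [self_mem_nhdsWithin] with r hr
        simpa [neg_inj] using hr
    refine ht.frequently (Eventually.frequently ?_)
    filter_upwards [nhdsWithin_le_nhds (Ioi_mem_nhds (zero_lt_one' ℝ))] with r hr
    exact hreal r hr
  have := h1.eqOn_of_preconnected_of_frequently_eq h2 hpre (z₀ := -1) (by simp) hfreq
    (show (-z) ∈ {w : ℂ | w.re < 0} by simpa using hz)
  simp only [neg_neg] at this
  rw [← this, key]
  simp

/-- The integrand of the Gamma integral with complex rate, extended by zero to `ℝ`. -/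
noncomputable def gammaKernel (b : ℝ) (z : ℂ) : ℝ → ℂ :=
  (Ioi 0).indicator fun y => ((y ^ (b - 1) : ℝ) : ℂ) * Complex.exp (-(z * y))

lemma gammaKernel_of_pos (b : ℝ) (z : ℂ) {y : ℝ} (hy : 0 < y) :
    gammaKernel b z y = ((y ^ (b - 1) : ℝ) : ℂ) * Complex.exp (-(z * y)) :=
  indicator_of_mem (mem_Ioi.2 hy) _

lemma gammaKernel_of_nonpos (b : ℝ) (z : ℂ) {y : ℝ} (hy : y ≤ 0) : gammaKernel b z y = 0 :=
  indicator_of_notMem (fun h => (not_lt.2 hy) (mem_Ioi.1 h)) _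

lemma measurable_gammaKernel (b : ℝ) (z : ℂ) : Measurable (gammaKernel b z) :=
  Measurable.indicator (by fun_prop) measurableSet_Ioi

lemma integrable_gammaKernel {b : ℝ} {z : ℂ} (hb : 0 < b) (hz : 0 < z.re) :
    Integrable (gammaKernel b z) :=
  (integrable_indicator_iff measurableSet_Ioi).2 (integrableOn_rpow_mul_cexp_neg_mul hb hz)

lemma integral_gammaKernel {b : ℝ} {z : ℂ} (hb : 0 < b) (hz : 0 < z.re) :
    ∫ y, gammaKernel b z y = z ^ (-(b : ℂ)) * (Real.Gamma b : ℂ) := by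
  rw [gammaKernel, integral_indicator measurableSet_Ioi, integral_rpow_mul_cexp_neg_mul hb hz]

/-! ### The Dirichlet integral. -/

/-- The unnormalised Dirichlet density, extended by zero off the open simplex. -/
noncomputable def dirichletKernel {n : ℕ} (b : Fin (n + 1) → ℝ) : (Fin n → ℝ) → ℝ :=
  (openSimplex n).indicator fun u =>
    (∏ i : Fin n, u i ^ (b i.castSucc - 1)) * (1 - ∑ i, u i) ^ (b (Fin.last n) - 1)

lemma measurableSet_openSimplex (n : ℕ) : MeasurableSet (openSimplex n) := by
  have : openSimplex n = (⋂ i, {u | 0 < u i}) ∩ {u | ∑ i, u i < 1} := by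
    ext u; simp [openSimplex]
  rw [this]
  refine (MeasurableSet.iInter fun i => measurableSet_lt measurable_const (by fun_prop)).inter
    (measurableSet_lt (by fun_prop) measurable_const)

/-- The linear form `∑ u_i z_i + (1 - ∑ u_i) z_{n+1}`. -/
noncomputable def simplexForm {n : ℕ} (z : Fin (n + 1) → ℂ) (u : Fin n → ℝ) : ℂ :=
  ∑ i : Fin n, (u i : ℂ) * z i.castSucc + ((1 - ∑ i, u i : ℝ) : ℂ) * z (Fin.last n)

lemma measurable_simplexForm {n : ℕ} (z : Fin (n + 1) → ℂ) : Measurable (simplexForm z) := by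
  unfold simplexForm
  fun_prop

lemma simplexForm_re_pos {n : ℕ} {z : Fin (n + 1) → ℂ} (hz : ∀ i, 0 < (z i).re) {u : Fin n → ℝ}
    (hu : u ∈ openSimplex n) : 0 < (simplexForm z u).re := by
  simp only [simplexForm, Complex.add_re, Complex.re_sum, Complex.re_ofReal_mul]
  have h1 : 0 < (1 - ∑ i, u i) * (z (Fin.last n)).re :=
    mul_pos (by linarith [hu.2]) (hz _)
  have h2 : 0 ≤ ∑ i : Fin n, u i * (z i.castSucc).re :=
    Finset.sum_nonneg fun i _ => (mul_pos (hu.1 i) (hz _)).le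
  linarith

/-- Passing from independent Gamma coordinates to their sum and their ratios. -/
lemma prod_gammaKernel_smul {n : ℕ} (b : Fin (n + 1) → ℝ) (z : Fin (n + 1) → ℂ) {s : ℝ}
    (hs : 0 < s) (u : Fin n → ℝ) :
    (s : ℂ) ^ n * ((∏ i : Fin n, gammaKernel (b i.castSucc) (z i.castSucc) ((s • u) i)) *
        gammaKernel (b (Fin.last n)) (z (Fin.last n)) (s - ∑ i, (s • u) i)) =
      (dirichletKernel b u : ℂ) * gammaKernel (∑ i, b i) (simplexForm z u) s := by
  have hsum : s - ∑ i, (s • u) i = s * (1 - ∑ i, u i) := by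
    simp only [Pi.smul_apply, smul_eq_mul, ← Finset.mul_sum]; ring
  rw [hsum]
  by_cases hu : u ∈ openSimplex n
  · have hu1 : 0 < 1 - ∑ i, u i := by linarith [hu.2]
    rw [dirichletKernel, indicator_of_mem hu, gammaKernel_of_pos _ _ hs,
      gammaKernel_of_pos _ _ (mul_pos hs hu1)]
    have : ∀ i : Fin n, gammaKernel (b i.castSucc) (z i.castSucc) ((s • u) i) =
        ((s ^ (b i.castSucc - 1) * u i ^ (b i.castSucc - 1) : ℝ) : ℂ) *
          Complex.exp (-(z i.castSucc * (s * u i : ℝ))) := by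
      intro i
      rw [Pi.smul_apply, smul_eq_mul, gammaKernel_of_pos _ _ (mul_pos hs (hu.1 i)),
        Real.mul_rpow hs.le (hu.1 i).le]
    simp only [this]
    rw [Finset.prod_mul_distrib, ← Complex.exp_sum, Real.mul_rpow hs.le hu1.le]
    have hexp : Complex.exp (-(simplexForm z u * s)) =
        Complex.exp (∑ i : Fin n, -(z i.castSucc * (s * u i : ℝ))) *
          Complex.exp (-(z (Fin.last n) * (s * (1 - ∑ i, u i) : ℝ))) := by
      rw [← Complex.exp_add]
      congr 1
      simp only [simplexForm, Complex.ofReal_mul, Finset.sum_neg_distrib, add_mul, Finset.sum_mul]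
      rw [neg_add]
      congr 2
      · exact Finset.sum_congr rfl fun i _ => by ring
      · ring
    -- The `n + 1` kernels contribute `∑ b_i - (n + 1)` to the exponent of `s`; the Jacobian `s^n`
    -- raises it to `∑ b_i - 1`.
    have hpow : s ^ (∑ i, b i - 1) =
        s ^ n * ((∏ i : Fin n, s ^ (b i.castSucc - 1)) * s ^ (b (Fin.last n) - 1)) := by
      rw [← Real.rpow_sum_of_pos hs, ← Real.rpow_natCast, ← Real.rpow_add hs, ← Real.rpow_add hs,
        Fin.sum_univ_castSucc]
      congr 1
      simp
      ring
    rw [hexp, hpow]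
    push_cast [Finset.prod_mul_distrib]
    ring
  -- Off the simplex some barycentric coordinate is nonpositive, so its Gamma kernel vanishes too.
  · rw [dirichletKernel, indicator_of_notMem hu]
    by_cases h : ∀ i, 0 < u i
    · have h1 : 1 - ∑ i, u i ≤ 0 := by
        by_contra! h'
        exact hu ⟨h, by linarith⟩
      rw [gammaKernel_of_nonpos _ _ (mul_nonpos_of_nonneg_of_nonpos hs.le h1)]
      simp
    · push Not at h
      obtain ⟨i, hi⟩ := h
      rw [Finset.prod_eq_zero (Finset.mem_univ i)]
      · simp
      · exact gammaKernel_of_nonpos _ _ (mul_nonpos_of_nonneg_of_nonpos hs.le hi)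

lemma measurable_dirichletKernel {n : ℕ} (b : Fin (n + 1) → ℝ) :
    Measurable (dirichletKernel b) :=
  Measurable.indicator (by fun_prop) (measurableSet_openSimplex n)

lemma measurable_gammaKernel_simplexForm {n : ℕ} (b : ℝ) (z : Fin (n + 1) → ℂ) :
    Measurable fun p : ℝ × (Fin n → ℝ) => gammaKernel b (simplexForm z p.2) p.1 := by
  have : (fun p : ℝ × (Fin n → ℝ) => gammaKernel b (simplexForm z p.2) p.1) =
      {p : ℝ × (Fin n → ℝ) | 0 < p.1}.indicator fun p =>
        ((p.1 ^ (b - 1) : ℝ) : ℂ) * Complex.exp (-(simplexForm z p.2 * p.1)) := by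
    ext p
    by_cases hp : 0 < p.1
    · rw [gammaKernel_of_pos _ _ hp, indicator_of_mem (by exact hp)]
    · rw [gammaKernel_of_nonpos _ _ (not_lt.1 hp), indicator_of_notMem (by exact hp)]
  rw [this]
  have := measurable_simplexForm z
  exact Measurable.indicator (by fun_prop) (measurableSet_lt measurable_const measurable_fst)

/-- The same absolutely convergent integral of a product of Gamma kernels is evaluated by Fubini in
two coordinate systems. The change of variables is split into a shear and, for each total `s`, a
dilation. -/
lemma integral_dirichletKernel {n : ℕ} (b : Fin (n + 1) → ℝ) (z : Fin (n + 1) → ℂ)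
    (hb : ∀ i, 0 < b i) (hz : ∀ i, 0 < (z i).re) :
    (∫ u, (dirichletKernel b u : ℂ) * simplexForm z u ^ (-((∑ i, b i : ℝ) : ℂ))) *
        (Real.Gamma (∑ i, b i) : ℂ) =
      ∏ i, (z i ^ (-(b i : ℂ)) * (Real.Gamma (b i) : ℂ)) := by
  have hB : 0 < ∑ i, b i := Finset.sum_pos (fun i _ => hb i) Finset.univ_nonempty
  set H : (Fin n → ℝ) × ℝ → ℂ := fun p =>
    (∏ i : Fin n, gammaKernel (b i.castSucc) (z i.castSucc) (p.1 i)) *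
      gammaKernel (b (Fin.last n)) (z (Fin.last n)) p.2 with hH
  have hHint : Integrable H (volume.prod volume) :=
    Integrable.mul_prod (Integrable.fintype_prod fun i => integrable_gammaKernel (hb _) (hz _))
      (integrable_gammaKernel (hb _) (hz _))
  have hHval : ∫ p, H p ∂(volume.prod volume) =
      ∏ i, (z i ^ (-(b i : ℂ)) * (Real.Gamma (b i) : ℂ)) := by
    rw [hH, integral_prod_mul (fun y : Fin n → ℝ =>
      ∏ i : Fin n, gammaKernel (b i.castSucc) (z i.castSucc) (y i)),
      integral_fintype_prod_volume_eq_prod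
        (fun i : Fin n => gammaKernel (b i.castSucc) (z i.castSucc)), Fin.prod_univ_castSucc]
    simp only [integral_gammaKernel (hb _) (hz _)]
  -- The shear recovers the last Gamma coordinate from the total; it preserves Lebesgue measure.
  set T : (Fin n → ℝ) × ℝ → (Fin n → ℝ) × ℝ := fun p => (p.1, p.2 - ∑ i, p.1 i) with hT
  have hTmp : MeasurePreserving T (volume.prod volume) (volume.prod volume) := by
    refine MeasurePreserving.skew_product (g := fun (y : Fin n → ℝ) (s : ℝ) => s - ∑ i, y i)
      (MeasurePreserving.id volume)
      (by unfold Function.uncurry; fun_prop) (ae_of_all _ fun y => ?_)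
    exact (measurePreserving_sub_right volume (∑ i, y i)).map_eq
  have hTemb : MeasurableEmbedding T := by
    refine MeasurableEquiv.measurableEmbedding
      { toFun := T, invFun := fun p => (p.1, p.2 + ∑ i, p.1 i), left_inv := fun p => by simp [hT],
        right_inv := fun p => by simp [hT]
        measurable_toFun := hTmp.measurable
        measurable_invFun := by
          change Measurable fun p : (Fin n → ℝ) × ℝ => (p.1, p.2 + ∑ i, p.1 i)
          fun_prop }
  set K : ℝ × (Fin n → ℝ) → ℂ := fun p => H (T p.swap) with hK
  have hKint : Integrable K (volume.prod volume) :=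
    (hTmp.integrable_comp_of_integrable hHint).swap
  have hKval : ∫ p, K p ∂(volume.prod volume) = ∫ p, H p ∂(volume.prod volume) := by
    rw [← hTmp.integral_comp hTemb H, ← integral_prod_swap]
    rfl
  have hKneg : ∀ s ≤ 0, ∀ y, K (s, y) = 0 := by
    intro s hs y
    simp only [hK, hH, hT, Prod.swap]
    by_cases h : ∀ i, 0 < y i
    · have : 0 ≤ ∑ i, y i := Finset.sum_nonneg fun i _ => (h i).le
      rw [gammaKernel_of_nonpos _ _ (by linarith), mul_zero]
    · push Not at h
      obtain ⟨i, hi⟩ := h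
      rw [Finset.prod_eq_zero (Finset.mem_univ i) (gammaKernel_of_nonpos _ _ hi), zero_mul]
  set J : ℝ × (Fin n → ℝ) → ℂ := fun p =>
    (dirichletKernel b p.2 : ℂ) * gammaKernel (∑ i, b i) (simplexForm z p.2) p.1 with hJ
  have hJmeas : Measurable J :=
    (Complex.measurable_ofReal.comp ((measurable_dirichletKernel b).comp measurable_snd)).mul
      (measurable_gammaKernel_simplexForm _ z)
  have hJneg : ∀ s ≤ 0, ∀ u, J (s, u) = 0 := fun s hs u => by
    simp [hJ, gammaKernel_of_nonpos _ _ hs]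
  have hJK : ∀ s, 0 < s → ∀ u, J (s, u) = (s : ℂ) ^ n * K (s, s • u) := fun s hs u =>
    (prod_gammaKernel_smul b z hs u).symm
  have hscale : ∀ s : ℝ, ∫ u, J (s, u) = ∫ y, K (s, y) := by
    intro s
    rcases le_or_gt s 0 with hs | hs
    · simp [hJneg s hs, hKneg s hs]
    · simp only [hJK s hs]
      rw [integral_const_mul, Measure.integral_comp_smul volume (fun y => K (s, y)),
        Module.finrank_fin_fun, abs_of_pos (by positivity), Complex.real_smul]
      push_cast
      rw [← mul_assoc, mul_inv_cancel₀ (pow_ne_zero _ (by exact_mod_cast hs.ne')), one_mul]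
  -- The dilation is repeated for norms in order to carry integrability from `K` to `J`.
  have hscale' : ∀ s : ℝ, ∫ u, ‖J (s, u)‖ = ∫ y, ‖K (s, y)‖ := by
    intro s
    rcases le_or_gt s 0 with hs | hs
    · simp [hJneg s hs, hKneg s hs]
    · simp only [hJK s hs, norm_mul, norm_pow, Complex.norm_real, Real.norm_of_nonneg hs.le]
      rw [integral_const_mul, Measure.integral_comp_smul volume (fun y => ‖K (s, y)‖),
        Module.finrank_fin_fun, abs_of_pos (by positivity), smul_eq_mul,
        ← mul_assoc, mul_inv_cancel₀ (by positivity), one_mul]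
  have hJint : Integrable J (volume.prod volume) := by
    rw [integrable_prod_iff hKint.aestronglyMeasurable] at hKint
    rw [integrable_prod_iff hJmeas.aestronglyMeasurable]
    refine ⟨?_, by simpa only [hscale'] using hKint.2⟩
    filter_upwards [hKint.1] with s h
    rcases le_or_gt s 0 with hs | hs
    · simp [hJneg s hs]
    · simp only [hJK s hs]
      exact (((integrable_comp_smul_iff volume (fun y => K (s, y)) hs.ne').2 h)).const_mul _
  have hJK' : ∫ p, J p ∂(volume.prod volume) = ∫ p, K p ∂(volume.prod volume) := by
    rw [integral_prod _ hJint, integral_prod _ hKint]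
    simp only [hscale]
  rw [← hHval, ← hKval, ← hJK', integral_prod_symm _ hJint, ← integral_mul_const]
  congr 1
  ext u
  simp only [hJ]
  rw [integral_const_mul, mul_assoc]
  by_cases hu : u ∈ openSimplex n
  · rw [integral_gammaKernel hB (simplexForm_re_pos hz hu)]
  · simp [dirichletKernel, hu]

/-- The generalised Stieltjes transform of the Dirichlet distribution. -/
theorem integral_simplexForm_cpow_dirichletMeasure {n : ℕ} (b : Fin (n + 1) → ℝ)
    (z : Fin (n + 1) → ℂ) (hb : ∀ i, 0 < b i) (hz : ∀ i, 0 < (z i).re) :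
    ∫ u, simplexForm z u ^ (-((∑ i, b i : ℝ) : ℂ)) ∂dirichletMeasure b =
      ∏ i, z i ^ (-(b i : ℂ)) := by
  have hB : 0 < ∑ i, b i := Finset.sum_pos (fun i _ => hb i) Finset.univ_nonempty
  have hΓ : ∀ i, 0 < Real.Gamma (b i) := fun i => Real.Gamma_pos_of_pos (hb i)
  have hP : 0 < ∏ i, Real.Gamma (b i) := Finset.prod_pos fun i _ => hΓ i
  have hmeas : Measurable (dirichletDensity b) := by
    unfold dirichletDensity
    fun_prop
  have h := integral_dirichletKernel b z hb hz
  rw [Finset.prod_mul_distrib, ← Complex.ofReal_prod] at h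
  have hP' : ((∏ i, Real.Gamma (b i) : ℝ) : ℂ) ≠ 0 := by exact_mod_cast hP.ne'
  have hdens : ∫ u, simplexForm z u ^ (-((∑ i, b i : ℝ) : ℂ)) ∂dirichletMeasure b =
      ∫ u, ((Real.Gamma (∑ i, b i) / ∏ i, Real.Gamma (b i) : ℝ) : ℂ) *
        ((dirichletKernel b u : ℂ) * simplexForm z u ^ (-((∑ i, b i : ℝ) : ℂ))) := by
    rw [dirichletMeasure, integral_withDensity_eq_integral_toReal_smul (by fun_prop) (by simp),
      ← integral_indicator (measurableSet_openSimplex n)]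
    congr 1
    ext u
    by_cases hu : u ∈ openSimplex n
    · have hu1 : 0 < 1 - ∑ i, u i := by linarith [hu.2]
      have hprod : 0 < ∏ i : Fin n, u i ^ (b i.castSucc - 1) :=
        Finset.prod_pos fun i _ => Real.rpow_pos_of_pos (hu.1 i) _
      have hd : 0 ≤ dirichletDensity b u := by
        have := Real.Gamma_pos_of_pos hB
        unfold dirichletDensity
        positivity
      rw [indicator_of_mem hu, ENNReal.toReal_ofReal hd, dirichletKernel, indicator_of_mem hu,
        dirichletDensity, Complex.real_smul]
      push_cast
      ring
    · simp [dirichletKernel, hu]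
  rw [hdens, integral_const_mul]
  refine mul_right_cancel₀ hP' ?_
  rw [← h]
  rw [Complex.ofReal_div, div_mul_eq_mul_div, div_mul_cancel₀ _ hP', mul_comm]

/-! ### Measurability in `φ` and the complex Markov–Krein identity. -/

lemma measurable_probabilityMeasure_real {B : Set ℝ} (hB : MeasurableSet B) :
    Measurable fun φ : ProbabilityMeasure ℝ => (φ : Measure ℝ).real B :=
  ((Measure.measurable_coe hB).comp measurable_subtype_coe).ennreal_toReal

lemma measurable_lintegral_probabilityMeasure {f : ℝ → ENNReal} (hf : Measurable f) :
    Measurable fun φ : ProbabilityMeasure ℝ => ∫⁻ x, f x ∂(φ : Measure ℝ) :=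
  (Measure.measurable_lintegral hf).comp measurable_subtype_coe

lemma measurable_integral_simpleFunc (f : SimpleFunc ℝ ℂ) :
    Measurable fun φ : ProbabilityMeasure ℝ => ∫ x, f x ∂(φ : Measure ℝ) := by
  have : (fun φ : ProbabilityMeasure ℝ => ∫ x, f x ∂(φ : Measure ℝ)) =
      fun φ : ProbabilityMeasure ℝ => ∑ c ∈ f.range, (φ : Measure ℝ).real (f ⁻¹' {c}) • c := by
    ext φ
    rw [← SimpleFunc.integral_eq_integral f (SimpleFunc.integrable_of_isFiniteMeasure f),
      SimpleFunc.integral_eq]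
  rw [this]
  exact Finset.measurable_sum _ fun c _ =>
    (measurable_probabilityMeasure_real (f.measurableSet_preimage _)).smul_const c

section

variable {α : Measure ℝ} {D : Measure (ProbabilityMeasure ℝ)}

/-- Pushed forward along `p`, both inner integrals become finite sums. Since `φ` has mass one, its
last cell mass is determined by the others and the sum is `simplexForm` of a Dirichlet vector. -/
lemma IsFunctionalDirichlet.integral_cpow_of_partition [IsFiniteMeasure α]
    (hD : IsFunctionalDirichlet α D) {n : ℕ}
    {p : ℝ → Fin (n + 1)} (hp : Measurable p) (hpos : ∀ i, 0 < α (p ⁻¹' {i}))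
    (z : Fin (n + 1) → ℂ) (hz : ∀ i, 0 < (z i).re) :
    ∫ φ : ProbabilityMeasure ℝ, (∫ x, z (p x) ∂(φ : Measure ℝ)) ^ (-(α.real univ : ℂ)) ∂D =
      Complex.exp (-∫ x, Complex.log (z (p x)) ∂α) := by
  have hsum : ∀ (μ : Measure ℝ) [IsFiniteMeasure μ] (w : Fin (n + 1) → ℂ),
      ∫ x, w (p x) ∂μ = ∑ i, (μ.real (p ⁻¹' {i}) : ℂ) * w i := by
    intro μ _ w
    rw [← integral_map (f := w) hp.aemeasurable (Measurable.of_discrete).aestronglyMeasurable,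
      integral_fintype (Integrable.of_finite)]
    refine Finset.sum_congr rfl fun i _ => ?_
    rw [map_measureReal_apply hp (measurableSet_singleton i), Complex.real_smul]
  have htot : ∀ (μ : Measure ℝ) [IsFiniteMeasure μ],
      μ.real univ = ∑ i, μ.real (p ⁻¹' {i}) := by
    intro μ _
    have := hsum μ (fun _ => 1)
    simp only [integral_const, Complex.real_smul, mul_one] at this
    exact_mod_cast this
  have hC : IsBorelPartition fun i => p ⁻¹' {i} :=
    { measurableSet := fun i => hp (measurableSet_singleton i)
      disjoint := fun i j hij => Disjoint.preimage _ (by simpa using hij)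
      iUnion_eq := by ext x; simp }
  have hb : ∀ i, 0 < α.real (p ⁻¹' {i}) := fun i =>
    ENNReal.toReal_pos (hpos i).ne' (measure_ne_top _ _)
  have hφ : ∀ φ : ProbabilityMeasure ℝ, ∫ x, z (p x) ∂(φ : Measure ℝ) =
      simplexForm z fun i => (φ : Measure ℝ).real (p ⁻¹' {i.castSucc}) := by
    intro φ
    have h1 := htot (φ : Measure ℝ)
    rw [probReal_univ, Fin.sum_univ_castSucc] at h1
    rw [hsum, Fin.sum_univ_castSucc, simplexForm, h1]
    simp
  simp only [hφ]
  have hmeas : Measurable fun φ : ProbabilityMeasure ℝ => fun i : Fin n =>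
      (φ : Measure ℝ).real (p ⁻¹' {i.castSucc}) :=
    measurable_pi_lambda _ fun i => measurable_probabilityMeasure_real (hC.measurableSet _)
  rw [← integral_map (f := fun u => simplexForm z u ^ (-(α.real univ : ℂ))) hmeas.aemeasurable
    ((measurable_simplexForm z).pow_const _).aestronglyMeasurable, hD.positive n _ hC hpos, htot α,
    integral_simplexForm_cpow_dirichletMeasure _ z hb hz, hsum α fun i => Complex.log (z i),
    ← Finset.sum_neg_distrib, Complex.exp_sum]
  refine Finset.prod_congr rfl fun i _ => ?_
  have : z i ≠ 0 := fun h => by simpa [h] using hz i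
  rw [Complex.cpow_def_of_ne_zero this]
  congr 1
  ring

lemma IsFunctionalDirichlet.ae_ae (hD : IsFunctionalDirichlet α D) {P : ℝ → Prop}
    (h : ∀ᵐ x ∂α, P x) : ∀ᵐ φ : ProbabilityMeasure ℝ ∂D, ∀ᵐ x ∂(φ : Measure ℝ), P x := by
  obtain ⟨B, hB, hBm, hB0⟩ := exists_measurable_superset_of_null h
  filter_upwards [hD.null B hBm hB0] with φ hφ
  exact measure_mono_null hB hφ

/-- Fibres of zero `α`-mass are merged into another cell, so that the strictly positive Dirichlet
law applies. The `z i` remain values of `f`, hence inherit its bound on the real part. -/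
lemma SimpleFunc.exists_partition_of_ne_zero (hα : α ≠ 0) (f : SimpleFunc ℝ ℂ) :
    ∃ (n : ℕ) (p : ℝ → Fin (n + 1)) (z : Fin (n + 1) → ℂ), Measurable p ∧
      (∀ i, 0 < α (p ⁻¹' {i})) ∧ (∀ i, ∃ x, z i = f x) ∧ ∀ᵐ x ∂α, f x = z (p x) := by
  classical
  set P : Finset ℂ := f.range.filter fun c => α (f ⁻¹' {c}) ≠ 0 with hP
  have hae : ∀ᵐ x ∂α, f x ∈ P := by
    have : ∀ c ∈ f.range, ∀ᵐ x ∂α, α (f ⁻¹' {c}) = 0 → f x ≠ c := by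
      intro c _
      by_cases h : α (f ⁻¹' {c}) = 0
      · filter_upwards [measure_eq_zero_iff_ae_notMem.1 h] with x hx _ hx'
        exact hx hx'
      · exact ae_of_all _ fun x h' => absurd h' h
    filter_upwards [(Finset.eventually_all f.range).2 this] with x hx
    rw [hP, Finset.mem_filter]
    exact ⟨f.mem_range_self x, fun h => hx _ (f.mem_range_self x) h rfl⟩
  have : NeZero α := ⟨hα⟩
  obtain ⟨x₀, hx₀⟩ := hae.exists
  obtain ⟨n, hn⟩ : ∃ n, P.card = n + 1 :=
    Nat.exists_eq_succ_of_ne_zero (Finset.card_ne_zero_of_mem hx₀)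
  let e : P ≃ Fin (n + 1) := P.equivFinOfCardEq hn
  let q : ℂ → Fin (n + 1) := fun c => if h : c ∈ P then e ⟨c, h⟩ else Fin.last n
  refine ⟨n, fun x => q (f x), fun i => (e.symm i : ℂ), (f.map q).measurable, fun i => ?_,
    fun i => ?_, ?_⟩
  · have hi := (Finset.mem_filter.1 (e.symm i).2).2
    refine lt_of_lt_of_le (pos_iff_ne_zero.2 hi) (measure_mono fun x hx => ?_)
    have hx' : f x = (e.symm i : ℂ) := hx
    have : f x ∈ P := hx' ▸ (e.symm i).2
    simp only [mem_preimage, mem_singleton_iff, q, dif_pos this]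
    rw [← e.apply_symm_apply i]
    congr 1
    exact Subtype.ext hx'
  · obtain ⟨x, hx⟩ := SimpleFunc.mem_range.1 (Finset.mem_filter.1 (e.symm i).2).1
    exact ⟨x, hx.symm⟩
  · filter_upwards [hae] with x hx
    simp [q, dif_pos hx]

lemma IsFunctionalDirichlet.integral_cpow_simpleFunc [IsFiniteMeasure α]
    (hD : IsFunctionalDirichlet α D) (hα : α ≠ 0)
    (f : SimpleFunc ℝ ℂ) (hf : ∀ x, 0 < (f x).re) :
    ∫ φ : ProbabilityMeasure ℝ, (∫ x, f x ∂(φ : Measure ℝ)) ^ (-(α.real univ : ℂ)) ∂D =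
      Complex.exp (-∫ x, Complex.log (f x) ∂α) := by
  obtain ⟨n, p, z, hp, hpos, hz, hae⟩ := SimpleFunc.exists_partition_of_ne_zero hα f
  have h := hD.integral_cpow_of_partition hp hpos z fun i => by
    obtain ⟨x, hx⟩ := hz i
    exact hx ▸ hf x
  rw [integral_congr_ae (g := fun x => Complex.log (z (p x))) (hae.mono fun x hx => by simp [hx]),
    ← h]
  refine integral_congr_ae ?_
  filter_upwards [hD.ae_ae hae] with φ hφ
  simp only [integral_congr_ae hφ]

lemma Complex.norm_cpow_neg_ofReal_le_one {w : ℂ} {a : ℝ} (ha : 0 ≤ a) (hw : 1 ≤ w.re) :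
    ‖w ^ (-(a : ℂ))‖ ≤ 1 := by
  rw [← Complex.ofReal_neg, Complex.norm_cpow_real]
  exact Real.rpow_le_one_of_one_le_of_nonpos (hw.trans (Complex.re_le_norm w)) (by linarith)

lemma one_le_re_integral {μ : Measure ℝ} [IsProbabilityMeasure μ] {f : ℝ → ℂ}
    (hf : Integrable f μ) (h : ∀ x, 1 ≤ (f x).re) : 1 ≤ (∫ x, f x ∂μ).re := by
  have h1 : (∫ x, f x ∂μ).re = ∫ x, (f x).re ∂μ := (integral_re hf).symm
  rw [h1]
  calc (1 : ℝ) = ∫ _, 1 ∂μ := by simp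
    _ ≤ _ := integral_mono (integrable_const _) hf.re h

/-- The Markov–Krein identity for complex functions with real part at least one. -/
theorem IsFunctionalDirichlet.integral_cpow [IsFiniteMeasure α]
    (hD : IsFunctionalDirichlet α D) (hα : α ≠ 0)
    {f : ℝ → ℂ} (hf : Measurable f) (hre : ∀ x, 1 ≤ (f x).re)
    (hlog : Integrable (fun x => Complex.log (f x)) α)
    (hint : ∀ᵐ φ : ProbabilityMeasure ℝ ∂D, Integrable f (φ : Measure ℝ)) :
    Integrable (fun φ : ProbabilityMeasure ℝ =>
      (∫ x, f x ∂(φ : Measure ℝ)) ^ (-(α.real univ : ℂ))) D ∧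
    ∫ φ : ProbabilityMeasure ℝ, (∫ x, f x ∂(φ : Measure ℝ)) ^ (-(α.real univ : ℂ)) ∂D =
      Complex.exp (-∫ x, Complex.log (f x) ∂α) := by
  have := hD.isProbabilityMeasure
  -- Approximating within this half-plane, from base point `1`, keeps every approximant away from
  -- the branch cut.
  set s : Set ℂ := {w | 1 ≤ w.re} with hs
  have h1s : (1 : ℂ) ∈ s := by simp [hs]
  set F : ℕ → SimpleFunc ℝ ℂ := SimpleFunc.approxOn f hf s 1 h1s with hF
  have hFs : ∀ n x, 1 ≤ (F n x).re := fun n x => SimpleFunc.approxOn_mem hf h1s n x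
  have hFt : ∀ x, Tendsto (fun n => F n x) atTop (𝓝 (f x)) := fun x =>
    SimpleFunc.tendsto_approxOn hf h1s (subset_closure (hre x))
  have hf1 : ∀ x, 1 ≤ ‖f x‖ := fun x => (hre x).trans (Complex.re_le_norm _)
  -- The approximant is no farther from `f x` than `1` is, so its norm is at most `1 + 2‖f x‖`, and
  -- `1 ≤ ‖f x‖`.
  have hFb : ∀ n x, ‖F n x‖ ≤ 3 * ‖f x‖ := by
    intro n x
    have h := SimpleFunc.edist_approxOn_le hf h1s x n
    rw [edist_dist, edist_dist, ENNReal.ofReal_le_ofReal_iff dist_nonneg, dist_eq_norm,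
      dist_eq_norm] at h
    have h2 : ‖F n x‖ ≤ ‖F n x - f x‖ + ‖f x‖ := by
      simpa using norm_add_le (F n x - f x) (f x)
    have h3 : ‖(1 : ℂ) - f x‖ ≤ 1 + ‖f x‖ := by simpa using norm_sub_le (1 : ℂ) (f x)
    linarith [hf1 x]
  have hslit : ∀ w : ℂ, 1 ≤ w.re → w ∈ Complex.slitPlane := fun w hw =>
    Or.inl (by linarith)
  have hR : Tendsto (fun n => ∫ x, Complex.log (F n x) ∂α) atTop
      (𝓝 (∫ x, Complex.log (f x) ∂α)) := by
    refine tendsto_integral_of_dominated_convergence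
      (fun x => ‖Complex.log (f x)‖ + (Real.log 3 + Real.pi)) (fun n => ?_)
      (hlog.norm.add (integrable_const _)) (fun n => ae_of_all _ fun x => ?_)
      (ae_of_all _ fun x => ?_)
    · exact ((F n).measurable.clog).aestronglyMeasurable
    · have h1 : 1 ≤ ‖F n x‖ := (hFs n x).trans (Complex.re_le_norm _)
      have h2 : Real.log ‖F n x‖ ≤ Real.log 3 + Real.log ‖f x‖ := by
        rw [← Real.log_mul (by norm_num) (by linarith [hf1 x])]
        exact Real.log_le_log (by linarith) (hFb n x)
      have h3 : Real.log ‖f x‖ ≤ ‖Complex.log (f x)‖ := by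
        rw [← Complex.log_re]; exact Complex.re_le_norm _
      calc ‖Complex.log (F n x)‖ ≤ |(Complex.log (F n x)).re| + |(Complex.log (F n x)).im| :=
            Complex.norm_le_abs_re_add_abs_im _
        _ ≤ Real.log ‖F n x‖ + Real.pi := by
            rw [Complex.log_re, Complex.log_im, abs_of_nonneg (Real.log_nonneg h1)]
            gcongr
            exact Complex.abs_arg_le_pi _
        _ ≤ _ := by linarith
    · exact ((continuousAt_clog (hslit _ (hre x))).tendsto).comp (hFt x)
  have hFi : ∀ (n : ℕ) (φ : ProbabilityMeasure ℝ), Integrable (F n) (φ : Measure ℝ) :=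
    fun n φ => SimpleFunc.integrable_of_isFiniteMeasure (F n)
  have hLmeas : ∀ n, AEStronglyMeasurable (fun φ : ProbabilityMeasure ℝ =>
      (∫ x, F n x ∂(φ : Measure ℝ)) ^ (-(α.real univ : ℂ))) D := fun n =>
    ((measurable_integral_simpleFunc (F n)).pow_const _).aestronglyMeasurable
  have hLt : ∀ᵐ φ : ProbabilityMeasure ℝ ∂D, Tendsto
      (fun n => (∫ x, F n x ∂(φ : Measure ℝ)) ^ (-(α.real univ : ℂ))) atTop
      (𝓝 ((∫ x, f x ∂(φ : Measure ℝ)) ^ (-(α.real univ : ℂ)))) := by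
    filter_upwards [hint] with φ hφ
    have h : Tendsto (fun n => ∫ x, F n x ∂(φ : Measure ℝ)) atTop
        (𝓝 (∫ x, f x ∂(φ : Measure ℝ))) :=
      tendsto_integral_of_dominated_convergence (fun x => 3 * ‖f x‖)
        (fun n => (hFi n φ).aestronglyMeasurable) (hφ.norm.const_mul 3)
        (fun n => ae_of_all _ (hFb n)) (ae_of_all _ hFt)
    exact h.cpow tendsto_const_nhds (hslit _ (one_le_re_integral hφ hre))
  have ha : 0 ≤ α.real univ := measureReal_nonneg
  have hL := tendsto_integral_of_dominated_convergence (fun _ => (1 : ℝ)) hLmeas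
    (integrable_const _) (fun n => ae_of_all _ fun φ =>
      Complex.norm_cpow_neg_ofReal_le_one ha (one_le_re_integral (hFi n φ) (hFs n))) hLt
  refine ⟨?_, ?_⟩
  · refine Integrable.mono' (integrable_const (1 : ℝ))
      (aestronglyMeasurable_of_tendsto_ae atTop hLmeas hLt) ?_
    filter_upwards [hint] with φ hφ
    exact Complex.norm_cpow_neg_ofReal_le_one ha (one_le_re_integral hφ hre)
  · have hF' : ∀ n x, 0 < (F n x).re := fun n x => zero_lt_one.trans_le (hFs n x)
    simp only [fun n => hD.integral_cpow_simpleFunc hα (F n) (hF' n)] at hL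
    exact tendsto_nhds_unique hL ((Complex.continuous_exp.tendsto _).comp hR.neg)

end

/-! ### The identity for real functions, with infinite values allowed. -/

section

variable {α : Measure ℝ} {D : Measure (ProbabilityMeasure ℝ)}

lemma IsFunctionalDirichlet.lintegral_rpow_of_bounded [IsFiniteMeasure α]
    (hD : IsFunctionalDirichlet α D) (hα : α ≠ 0) {f : ℝ → ℝ} (hf : Measurable f)
    (h1 : ∀ x, 1 ≤ f x) {C : ℝ} (hC : ∀ x, f x ≤ C) :
    ∫⁻ φ : ProbabilityMeasure ℝ,
        (∫⁻ x, ENNReal.ofReal (f x) ∂(φ : Measure ℝ)) ^ (-α.real univ) ∂D =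
      ENNReal.ofReal (Real.exp (-∫ x, Real.log (f x) ∂α)) := by
  have hbdd : ∀ (μ : Measure ℝ) [IsFiniteMeasure μ], Integrable f μ := fun μ _ =>
    Integrable.of_bound hf.aestronglyMeasurable C (ae_of_all _ fun x => by
      rw [Real.norm_of_nonneg (zero_le_one.trans (h1 x))]; exact hC x)
  have hlog : Integrable (fun x => Real.log (f x)) α :=
    Integrable.of_bound hf.log.aestronglyMeasurable (Real.log C) (ae_of_all _ fun x => by
      rw [Real.norm_of_nonneg (Real.log_nonneg (h1 x))]
      exact Real.log_le_log (zero_lt_one.trans_le (h1 x)) (hC x))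
  have hclog : ∀ x, Complex.log (f x : ℂ) = (Real.log (f x) : ℂ) := fun x =>
    (Complex.ofReal_log (zero_le_one.trans (h1 x))).symm
  have hpos : ∀ φ : ProbabilityMeasure ℝ, 0 < ∫ x, f x ∂(φ : Measure ℝ) := fun φ => by
    have : ∫ _, (1 : ℝ) ∂(φ : Measure ℝ) ≤ ∫ x, f x ∂(φ : Measure ℝ) :=
      integral_mono (integrable_const _) (hbdd _) h1
    simp only [integral_const, probReal_univ, smul_eq_mul, mul_one] at this
    linarith
  obtain ⟨hint, heq⟩ := hD.integral_cpow hα (f := fun x => (f x : ℂ))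
    (Complex.measurable_ofReal.comp hf) (fun x => by simpa using h1 x)
    (by simp only [hclog]; exact hlog.ofReal) (ae_of_all _ fun φ => (hbdd _).ofReal)
  have hcpow : ∀ φ : ProbabilityMeasure ℝ,
      (∫ x, (f x : ℂ) ∂(φ : Measure ℝ)) ^ (-(α.real univ : ℂ)) =
        (((∫ x, f x ∂(φ : Measure ℝ)) ^ (-α.real univ) : ℝ) : ℂ) := fun φ => by
    rw [integral_complex_ofReal, Complex.ofReal_cpow (hpos φ).le, Complex.ofReal_neg]
  simp only [hcpow, hclog] at hint heq
  rw [integral_complex_ofReal, integral_complex_ofReal, ← Complex.ofReal_neg,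
    ← Complex.ofReal_exp, Complex.ofReal_inj] at heq
  rw [← heq, ofReal_integral_eq_lintegral_ofReal (by simpa using hint.re)
    (ae_of_all _ fun φ => Real.rpow_nonneg (hpos φ).le _)]
  refine lintegral_congr fun φ => ?_
  rw [← ENNReal.ofReal_rpow_of_pos (hpos φ), ofReal_integral_eq_lintegral_ofReal (hbdd _)
    (ae_of_all _ fun x => zero_le_one.trans (h1 x))]

/-- The bounded identity is applied to truncations. The inner integrals converge monotonically,
possibly to `⊤`, where the negative power is still continuous; the outer integrands are bounded by
`1`. -/
lemma IsFunctionalDirichlet.tendsto_exp_neg_lintegral_log_min [IsFiniteMeasure α]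
    (hD : IsFunctionalDirichlet α D) (hα : α ≠ 0) {f : ℝ → ℝ} (hf : Measurable f)
    (h1 : ∀ x, 1 ≤ f x) :
    Tendsto (fun k : ℕ => ENNReal.ofReal (Real.exp
        (-(∫⁻ x, ENNReal.ofReal (Real.log (min (f x) (k + 1))) ∂α).toReal))) atTop
      (𝓝 (∫⁻ φ : ProbabilityMeasure ℝ,
        (∫⁻ x, ENNReal.ofReal (f x) ∂(φ : Measure ℝ)) ^ (-α.real univ) ∂D)) := by
  have := hD.isProbabilityMeasure
  have hm : ∀ k : ℕ, Measurable fun x => min (f x) (k + 1) := fun k => hf.min measurable_const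
  -- Truncating at `k + 1` rather than `k` keeps this true at `k = 0`.
  have hm1 : ∀ (k : ℕ) x, 1 ≤ min (f x) (k + 1) := fun k x =>
    le_min (h1 x) (by linarith [k.cast_nonneg (α := ℝ)])
  have heq : ∀ k : ℕ, ENNReal.ofReal (Real.exp
        (-(∫⁻ x, ENNReal.ofReal (Real.log (min (f x) (k + 1))) ∂α).toReal)) =
      ∫⁻ φ : ProbabilityMeasure ℝ, (∫⁻ x, ENNReal.ofReal (min (f x) (k + 1))
        ∂(φ : Measure ℝ)) ^ (-α.real univ) ∂D := by
    intro k
    rw [hD.lintegral_rpow_of_bounded hα (hm k) (hm1 k) (C := k + 1) fun x => min_le_right _ _,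
      integral_eq_lintegral_of_nonneg_ae (ae_of_all _ fun x => Real.log_nonneg (hm1 k x))
        (hm k).log.aestronglyMeasurable]
  simp only [heq]
  refine tendsto_lintegral_of_dominated_convergence (fun _ => 1) (fun k => ?_) (fun k => ?_)
    (by simp) (ae_of_all _ fun φ => ?_)
  · exact (measurable_lintegral_probabilityMeasure (hm k).ennreal_ofReal).pow_const _
  · refine ae_of_all _ fun φ => ?_
    dsimp only
    rw [ENNReal.rpow_neg]
    refine ENNReal.inv_le_one.2 (ENNReal.one_le_rpow ?_ ?_)
    · calc (1 : ENNReal) = ∫⁻ _, 1 ∂(φ : Measure ℝ) := by simp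
        _ ≤ _ := lintegral_mono fun x => by simpa using hm1 k x
    · exact ENNReal.toReal_pos (by simpa using hα) (measure_ne_top _ _)
  · refine ((ENNReal.continuous_rpow_const).tendsto _).comp
      (lintegral_tendsto_of_tendsto_of_monotone (fun k => (hm k).ennreal_ofReal.aemeasurable)
        (ae_of_all _ fun x k l hkl => ?_) (ae_of_all _ fun x => ?_))
    · have : (k : ℝ) ≤ l := by exact_mod_cast hkl
      dsimp only
      gcongr
    · refine tendsto_const_nhds.congr' ?_
      filter_upwards [eventually_ge_atTop ⌈f x⌉₊] with k hk
      rw [min_eq_left]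
      linarith [Nat.ceil_le.1 hk]

lemma tendsto_lintegral_log_min {f : ℝ → ℝ} (hf : Measurable f) (h1 : ∀ x, 1 ≤ f x) :
    Tendsto (fun k : ℕ => ∫⁻ x, ENNReal.ofReal (Real.log (min (f x) (k + 1))) ∂α) atTop
      (𝓝 (∫⁻ x, ENNReal.ofReal (Real.log (f x)) ∂α)) := by
  refine lintegral_tendsto_of_tendsto_of_monotone
    (fun k => ((hf.min measurable_const).log).ennreal_ofReal.aemeasurable)
    (ae_of_all _ fun x k l hkl => ?_) (ae_of_all _ fun x => ?_)
  · have : (k : ℝ) ≤ l := by exact_mod_cast hkl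
    have h0 : 0 < min (f x) ((k : ℝ) + 1) :=
      lt_min (zero_lt_one.trans_le (h1 x)) (by positivity)
    dsimp only
    gcongr
  · refine tendsto_const_nhds.congr' ?_
    filter_upwards [eventually_ge_atTop ⌈f x⌉₊] with k hk
    rw [min_eq_left]
    linarith [Nat.ceil_le.1 hk]

theorem IsFunctionalDirichlet.lintegral_rpow [IsFiniteMeasure α]
    (hD : IsFunctionalDirichlet α D) (hα : α ≠ 0) {f : ℝ → ℝ} (hf : Measurable f)
    (h1 : ∀ x, 1 ≤ f x) (hlog : ∫⁻ x, ENNReal.ofReal (Real.log (f x)) ∂α ≠ ⊤) :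
    ∫⁻ φ : ProbabilityMeasure ℝ,
        (∫⁻ x, ENNReal.ofReal (f x) ∂(φ : Measure ℝ)) ^ (-α.real univ) ∂D =
      ENNReal.ofReal (Real.exp (-(∫⁻ x, ENNReal.ofReal (Real.log (f x)) ∂α).toReal)) := by
  refine tendsto_nhds_unique (hD.tendsto_exp_neg_lintegral_log_min hα hf h1) ?_
  refine (ENNReal.continuous_ofReal.tendsto _).comp ((Real.continuous_exp.tendsto _).comp ?_)
  exact ((ENNReal.tendsto_toReal hlog).comp (tendsto_lintegral_log_min hf h1)).neg

/-- The divergent case is separate because `toReal` sends `⊤` to `0`, which would turn the limit `0`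
into `exp 0 = 1`. -/
theorem IsFunctionalDirichlet.lintegral_rpow_eq_zero [IsFiniteMeasure α]
    (hD : IsFunctionalDirichlet α D) (hα : α ≠ 0) {f : ℝ → ℝ} (hf : Measurable f)
    (h1 : ∀ x, 1 ≤ f x) (hlog : ∫⁻ x, ENNReal.ofReal (Real.log (f x)) ∂α = ⊤) :
    ∫⁻ φ : ProbabilityMeasure ℝ,
        (∫⁻ x, ENNReal.ofReal (f x) ∂(φ : Measure ℝ)) ^ (-α.real univ) ∂D = 0 := by
  refine tendsto_nhds_unique (hD.tendsto_exp_neg_lintegral_log_min hα hf h1) ?_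
  rw [← ENNReal.ofReal_zero]
  refine (ENNReal.continuous_ofReal.tendsto _).comp
    (Real.tendsto_exp_neg_atTop_nhds_zero.comp ?_)
  have ht := tendsto_lintegral_log_min (α := α) hf h1
  rw [hlog, ENNReal.tendsto_nhds_top_iff_nnreal] at ht
  refine tendsto_atTop.2 fun r => ?_
  filter_upwards [ht r.toNNReal] with k hk
  have hfin : ∫⁻ x, ENNReal.ofReal (Real.log (min (f x) (k + 1))) ∂α ≠ ⊤ := by
    refine (lt_of_le_of_lt (lintegral_mono (g := fun _ => ENNReal.ofReal (Real.log (k + 1)))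
      fun x => ?_) ?_).ne
    · have h0 : 0 < min (f x) ((k : ℝ) + 1) :=
        lt_min (zero_lt_one.trans_le (h1 x)) (by positivity)
      exact ENNReal.ofReal_le_ofReal (Real.log_le_log h0 (min_le_right _ _))
    · rw [lintegral_const]
      exact ENNReal.mul_lt_top ENNReal.ofReal_lt_top (measure_lt_top _ _)
  exact (ENNReal.ofReal_le_iff_le_toReal hfin).1 hk.le

/-! ### The logarithmic moment dichotomy and the transform of the mean. -/

lemma measurableSet_finiteMeanSet : MeasurableSet finiteMeanSet :=
  measurableSet_lt (measurable_lintegral_probabilityMeasure (by fun_prop)) measurable_const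

lemma lintegral_one_add_mul_abs_lt_top_iff {t : ℝ} (ht : 0 < t) (φ : ProbabilityMeasure ℝ) :
    ∫⁻ x, ENNReal.ofReal (1 + t * |x|) ∂(φ : Measure ℝ) < ⊤ ↔ φ ∈ finiteMeanSet := by
  have : ∫⁻ x, ENNReal.ofReal (1 + t * |x|) ∂(φ : Measure ℝ) =
      1 + ENNReal.ofReal t * ∫⁻ x, ENNReal.ofReal |x| ∂(φ : Measure ℝ) := by
    simp only [ENNReal.ofReal_add zero_le_one (mul_nonneg ht.le (abs_nonneg _)),
      ENNReal.ofReal_mul ht.le]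
    rw [lintegral_add_left measurable_const, lintegral_const_mul _ (by fun_prop)]
    simp
  rw [this, ENNReal.add_lt_top, ENNReal.mul_lt_top_iff]
  simp [finiteMeanSet, not_le.2 ht]
  intro h
  simp [h]

/-- A nonnegative function with zero integral vanishes almost everywhere, and a power with exponent
`-a ≤ 0` vanishes only at `⊤`. -/
lemma IsFunctionalDirichlet.finiteMeanSet_eq_zero [IsFiniteMeasure α]
    (hD : IsFunctionalDirichlet α D) (hα : α ≠ 0)
    (hlog : ∫⁻ x, ENNReal.ofReal (Real.log (1 + |x|)) ∂α = ⊤) : D finiteMeanSet = 0 := by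
  have h := hD.lintegral_rpow_eq_zero hα (f := fun x => 1 + 1 * |x|) (by fun_prop)
    (fun x => by simp) (by simpa using hlog)
  rw [lintegral_eq_zero_iff
    ((measurable_lintegral_probabilityMeasure (by fun_prop)).pow_const _)] at h
  refine measure_mono_null (fun φ hφ => ?_) h
  have h2 := ((lintegral_one_add_mul_abs_lt_top_iff one_pos φ).2 hφ).ne
  have ha : 0 ≤ α.real univ := measureReal_nonneg
  simp only [mem_compl_iff, mem_ofPred_eq, Pi.zero_apply, ENNReal.rpow_eq_zero_iff]
  rintro (⟨-, h⟩ | ⟨h, -⟩)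
  · linarith
  · exact h2 h

/-- With `ε = 1 / (n + 1)`, the power `(∫ (1 + ε|x|) dφ)^(-a)` is at most the indicator of `L`, so
`D(L) ≥ exp (-∫ log (1 + ε|x|) dα)`, which tends to `1` by dominated convergence. -/
lemma IsFunctionalDirichlet.finiteMeanSet_eq_one [IsFiniteMeasure α]
    (hD : IsFunctionalDirichlet α D) (hα : α ≠ 0)
    (hlog : ∫⁻ x, ENNReal.ofReal (Real.log (1 + |x|)) ∂α < ⊤) : D finiteMeanSet = 1 := by
  have := hD.isProbabilityMeasure
  have ha : 0 < α.real univ := ENNReal.toReal_pos (by simpa using hα) (measure_ne_top _ _)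
  have hε : ∀ n : ℕ, (0 : ℝ) < 1 / (n + 1) := fun n => by positivity
  have hε1 : ∀ n : ℕ, (1 : ℝ) / (n + 1) ≤ 1 := fun n =>
    (div_le_one (by positivity)).2 (by linarith [n.cast_nonneg (α := ℝ)])
  have hf1 : ∀ (n : ℕ) (x : ℝ), 1 ≤ 1 + 1 / (n + 1) * |x| := fun n x => by
    have := mul_nonneg (hε n).le (abs_nonneg x)
    linarith
  have hle : ∀ (n : ℕ) (x : ℝ), ENNReal.ofReal (Real.log (1 + 1 / (n + 1) * |x|)) ≤
      ENNReal.ofReal (Real.log (1 + |x|)) := fun n x => by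
    have := mul_le_of_le_one_left (abs_nonneg x) (hε1 n)
    exact ENNReal.ofReal_le_ofReal
      (Real.log_le_log (zero_lt_one.trans_le (hf1 n x)) (by linarith))
  have hlim : Tendsto (fun n : ℕ => ∫⁻ x, ENNReal.ofReal (Real.log (1 + 1 / (n + 1) * |x|)) ∂α)
      atTop (𝓝 0) := by
    rw [show (0 : ENNReal) = ∫⁻ _, 0 ∂α by simp]
    refine tendsto_lintegral_of_dominated_convergence
      (fun x => ENNReal.ofReal (Real.log (1 + |x|))) (fun n => by fun_prop)
      (fun n => ae_of_all _ (hle n)) hlog.ne (ae_of_all _ fun x => ?_)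
    have h1 : Tendsto (fun n : ℕ => 1 + (1 : ℝ) / (n + 1) * |x|) atTop (𝓝 1) := by
      simpa using ((tendsto_one_div_add_atTop_nhds_zero_nat (𝕜 := ℝ)).mul_const |x|).const_add 1
    have h2 := (ENNReal.continuous_ofReal.tendsto _).comp
      (((Real.continuousAt_log one_ne_zero).tendsto).comp h1)
    rw [Real.log_one, ENNReal.ofReal_zero] at h2
    exact h2
  have hbound : ∀ n : ℕ, ENNReal.ofReal (Real.exp
      (-(∫⁻ x, ENNReal.ofReal (Real.log (1 + 1 / (n + 1) * |x|)) ∂α).toReal)) ≤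
        D finiteMeanSet := by
    intro n
    rw [← hD.lintegral_rpow hα (f := fun x => 1 + 1 / (n + 1) * |x|) (by fun_prop) (hf1 n)
      ((lintegral_mono (hle n)).trans_lt hlog).ne, ← lintegral_indicator_one
      measurableSet_finiteMeanSet]
    refine lintegral_mono fun φ => ?_
    by_cases hφ : φ ∈ finiteMeanSet
    · rw [indicator_of_mem hφ, ENNReal.rpow_neg]
      refine ENNReal.inv_le_one.2 (ENNReal.one_le_rpow ?_ ha)
      calc (1 : ENNReal) = ∫⁻ _, 1 ∂(φ : Measure ℝ) := by simp
        _ ≤ _ := lintegral_mono fun x => by simpa using mul_nonneg (hε n).le (abs_nonneg x)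
    · have h := hφ
      rw [← lintegral_one_add_mul_abs_lt_top_iff (hε n), not_lt_top_iff] at h
      simp only [h, ENNReal.top_rpow_of_neg (neg_lt_zero.2 ha), zero_le]
  refine le_antisymm prob_le_one (le_of_tendsto' (x := atTop) ?_ hbound)
  rw [show (1 : ENNReal) = ENNReal.ofReal (Real.exp (-(0 : ENNReal).toReal)) by simp]
  refine (ENNReal.continuous_ofReal.tendsto _).comp ((Real.continuous_exp.tendsto _).comp ?_)
  exact ((ENNReal.tendsto_toReal ENNReal.zero_ne_top).comp hlim).neg

/-- The modulus lies between `1` and `(1 + |t|)(1 + |x|)`, and the argument is bounded by `π`. -/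
lemma integrable_clog_one_add_I_mul [IsFiniteMeasure α]
    (hlog : ∫⁻ x, ENNReal.ofReal (Real.log (1 + |x|)) ∂α < ⊤) (t : ℝ) :
    Integrable (fun x : ℝ => Complex.log (1 + Complex.I * (t : ℂ) * (x : ℂ))) α := by
  have hl0 : ∀ x : ℝ, 0 ≤ Real.log (1 + |x|) := fun x =>
    Real.log_nonneg (by linarith [abs_nonneg x])
  have hint : Integrable (fun x : ℝ => Real.log (1 + |x|)) α :=
    ⟨Measurable.aestronglyMeasurable (by fun_prop),
      (hasFiniteIntegral_iff_ofReal (ae_of_all _ hl0)).2 hlog⟩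
  refine Integrable.mono' (((integrable_const (Real.log (1 + |t|))).add hint).add
    (integrable_const Real.pi)) (Measurable.aestronglyMeasurable (by fun_prop))
    (ae_of_all _ fun x => ?_)
  set w : ℂ := 1 + Complex.I * t * x with hw
  have h1 : 1 ≤ ‖w‖ := by simpa [hw] using Complex.re_le_norm w
  have h2 : ‖w‖ ≤ (1 + |t|) * (1 + |x|) := by
    have : ‖w‖ ≤ 1 + |t| * |x| := (norm_add_le _ _).trans (by simp)
    nlinarith [abs_nonneg t, abs_nonneg x]
  calc ‖Complex.log w‖ ≤ |(Complex.log w).re| + |(Complex.log w).im| :=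
        Complex.norm_le_abs_re_add_abs_im _
    _ ≤ Real.log ‖w‖ + Real.pi := by
        rw [Complex.log_re, Complex.log_im, abs_of_nonneg (Real.log_nonneg h1)]
        gcongr
        exact Complex.abs_arg_le_pi _
    _ ≤ Real.log (1 + |t|) + Real.log (1 + |x|) + Real.pi := by
        rw [← Real.log_mul (by positivity) (by positivity)]
        gcongr

end

theorem theorem1 (α : Measure ℝ) [IsFiniteMeasure α] (a : ℝ) (ha : 0 < a)
    (hαa : α Set.univ = ENNReal.ofReal a)
    (D : Measure (ProbabilityMeasure ℝ)) (hD : IsFunctionalDirichlet α D) :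
    (D finiteMeanSet = 0 ∨ D finiteMeanSet = 1) ∧
    (D finiteMeanSet = 1 ↔ ∫⁻ x, ENNReal.ofReal (Real.log (1 + |x|)) ∂α < ⊤) ∧
    (D finiteMeanSet = 1 → ∀ t : ℝ,
      Integrable (fun φ : ProbabilityMeasure ℝ =>
        (1 + Complex.I * (t : ℂ) * ((∫ x, x ∂(φ : Measure ℝ) : ℝ) : ℂ)) ^ (-(a : ℂ))) D ∧
      Integrable (fun x : ℝ => Complex.log (1 + Complex.I * (t : ℂ) * (x : ℂ))) α ∧
      ∫ φ : ProbabilityMeasure ℝ,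
          (1 + Complex.I * (t : ℂ) * ((∫ x, x ∂(φ : Measure ℝ) : ℝ) : ℂ)) ^ (-(a : ℂ)) ∂D =
        Complex.exp (-∫ x : ℝ, Complex.log (1 + Complex.I * (t : ℂ) * (x : ℂ)) ∂α)) := by
  have hα : α ≠ 0 := by
    rintro rfl
    simp at hαa
    linarith
  have hreal : α.real univ = a := by rw [measureReal_def, hαa, ENNReal.toReal_ofReal ha.le]
  have := hD.isProbabilityMeasure
  have hiff : D finiteMeanSet = 1 ↔ ∫⁻ x, ENNReal.ofReal (Real.log (1 + |x|)) ∂α < ⊤ := by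
    refine ⟨fun h => lt_top_iff_ne_top.2 fun h' => ?_, hD.finiteMeanSet_eq_one hα⟩
    exact zero_ne_one ((hD.finiteMeanSet_eq_zero hα h').symm.trans h)
  refine ⟨?_, hiff, fun h t => ?_⟩
  · by_cases hlog : ∫⁻ x, ENNReal.ofReal (Real.log (1 + |x|)) ∂α = ⊤
    · exact Or.inl (hD.finiteMeanSet_eq_zero hα hlog)
    · exact Or.inr (hD.finiteMeanSet_eq_one hα (lt_top_iff_ne_top.2 hlog))
  have hlog := integrable_clog_one_add_I_mul (hiff.1 h) t
  have hid : ∀ᵐ φ : ProbabilityMeasure ℝ ∂D, Integrable (fun x : ℝ => x) (φ : Measure ℝ) := by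
    filter_upwards [(prob_compl_eq_zero_iff measurableSet_finiteMeanSet).2 h |>
      measure_eq_zero_iff_ae_notMem.1] with φ hφ
    refine ⟨measurable_id.aestronglyMeasurable, ?_⟩
    rw [hasFiniteIntegral_iff_norm]
    simpa [finiteMeanSet, lt_top_iff_ne_top] using hφ
  obtain ⟨h1, h2⟩ := hD.integral_cpow hα (f := fun x : ℝ => 1 + Complex.I * (t : ℂ) * (x : ℂ))
    (by fun_prop) (fun x => by simp) hlog
    (hid.mono fun φ hφ => (integrable_const _).add (hφ.ofReal.const_mul _))
  have hae : (fun φ : ProbabilityMeasure ℝ =>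
      (∫ x : ℝ, (1 + Complex.I * (t : ℂ) * (x : ℂ)) ∂(φ : Measure ℝ)) ^ (-(α.real univ : ℂ)))
      =ᵐ[D] fun φ => (1 + Complex.I * (t : ℂ) *
        ((∫ x, x ∂(φ : Measure ℝ) : ℝ) : ℂ)) ^ (-(a : ℂ)) := by
    filter_upwards [hid] with φ hφ
    rw [integral_add (integrable_const _) (hφ.ofReal.const_mul _), integral_const_mul,
      integral_complex_ofReal, hreal]
    simp
  exact ⟨h1.congr hae, hlog, by rw [← integral_congr_ae hae, h2]⟩
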